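/- Let $\mathbb{K}$ be an algebraically closed field of characteristic $0$. For $f\in\mathbb{K}(x)$ and $g\in\mathbb{K}(y)$ write $f=f_n/f_d$ and $g=g_n/g_d$ in reduced form (coprime numerator and denominator; we take the denominators to be monic, any other choice changes the polynomial below only by a nonzero constant factor). A polynomial in $\mathbb{K}[x,y]$ is called near-separated if it is equal to $f_ng_d-g_nf_d$ for some $f\in\mathbb{K}(x)$ and $g\in\mathbb{K}(y)$; in particular $0$ is near-separated (take $f=g$ constant). Let $p\in\mathbb{K}[x,y]$ be irreducible. Then $p$ has a near-separated multiple that divides every near-separated multiple of $p$. It is unique up to multiplication by a nonzero constant of $\mathbb{K}$, and it is called the minimal near-separated multiple of $p$ (it is $0$ exactly when $p$ has no nonzero near-separated multiple). Assume in addition that $p\notin\mathbb{K}[x]\cup\mathbb{K}[y]$. Let $\mathbb{K}[x,y]_p\subseteq\mathbb{K}(x,y)$ be the ring of all fractions $a/b$ with $a,b\in\mathbb{K}[x,y]$ and $p\nmid b$, let $\langle p\rangle$ be the ideal generated by $p$ in it, and let $$\mathrm{F}(p)=\{(f,g)\in\mathbb{K}(x)\times\mathbb{K}(y) : f-g\in\langle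 p\rangle\}$$ be the field of separated multiples of $p$, with componentwise operations. For $(f,g)\in\mathbb{K}(x)\times\mathbb{K}(y)$ let $\mathbb{K}((f,g))$ be the set of all $(h(f),h(g))$, where $h=a/b$ with $a,b\in\mathbb{K}[t]$, $b(f)\neq 0$ and $b(g)\neq 0$. Then, for all $f\in\mathbb{K}(x)$ and $g\in\mathbb{K}(y)$, $$\mathrm{F}(p)=\mathbb{K}((f,g))\quad\Longleftrightarrow\quad f_ng_d-g_nf_d\ \text{is the minimal near-separated multiple of } p \text{ (up to a nonzero constant)}.$$ -/

import Mathlib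

noncomputable section

namespace NearSep

variable (K : Type*) [Field K]

/-- The polynomial ring `K[x,y]`; the variable `x` is `X 0` and `y` is `X 1`. -/
abbrev Poly₂ : Type _ := MvPolynomial (Fin 2) K

/-- The field `K(x,y)` of rational functions. -/
abbrev Rat₂ : Type _ := FractionRing (Poly₂ K)

variable {K}

/-- The element `f(x)` (for `i = 0`) or `f(y)` (for `i = 1`) of `K(x,y)`, for a univariate
rational function `f`. -/
def inVar (i : Fin 2) (f : RatFunc K) : Rat₂ K :=
  f.eval (algebraMap K (Rat₂ K)) (algebraMap (Poly₂ K) (Rat₂ K) (MvPolynomial.X i))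

/-- For `f = f_n / f_d` in `K(x)` and `g = g_n / g_d` in `K(y)` in reduced form, the polynomial
`f_n g_d - g_n f_d`. (The denominators are normalized to be monic; another choice of the reduced
forms changes the polynomial by a nonzero constant factor only.) -/
def crossDiff (f g : RatFunc K) : Poly₂ K :=
  Polynomial.aeval (MvPolynomial.X 0) f.num * Polynomial.aeval (MvPolynomial.X 1) g.denom
    - Polynomial.aeval (MvPolynomial.X 1) g.num * Polynomial.aeval (MvPolynomial.X 0) f.denom

/-- A polynomial is near-separated if it is of the form `f_n g_d - g_n f_d`. -/
def IsNearSeparated (p : Poly₂ K) : Prop :=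
  ∃ f g : RatFunc K, p = crossDiff f g

/-- `m` is a near-separated multiple of `p` that divides every near-separated multiple of `p`. -/
def IsMinimalNearSeparatedMultiple (p m : Poly₂ K) : Prop :=
  IsNearSeparated m ∧ p ∣ m ∧ ∀ q : Poly₂ K, IsNearSeparated q → p ∣ q → m ∣ q

/-- The local ring `K[x,y]_p` inside `K(x,y)`: the fractions whose denominator is not a multiple
of `p`. -/
def localRing (p : Poly₂ K) : Set (Rat₂ K) :=
  {r | ∃ a b : Poly₂ K, ¬ p ∣ b ∧
    r = algebraMap (Poly₂ K) (Rat₂ K) a / algebraMap (Poly₂ K) (Rat₂ K) b}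

/-- The ideal `⟨p⟩` generated by `p` in `K[x,y]_p`. -/
def localIdeal (p : Poly₂ K) : Set (Rat₂ K) :=
  {r | ∃ s ∈ localRing p, r = algebraMap (Poly₂ K) (Rat₂ K) p * s}

/-- The field of separated multiples
`F(p) = {(f, g) ∈ K(x) × K(y) : f - g ∈ ⟨p⟩}`, as a subset of the ring `K(x) × K(y)`. -/
def sepField (p : Poly₂ K) : Set (RatFunc K × RatFunc K) :=
  {fg | inVar 0 fg.1 - inVar 1 fg.2 ∈ localIdeal p}

/-- `K((f,g))`: the values `h((f,g)) = (h(f), h(g))` of the rational functions `h = a / b` over `K`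
that are defined at `(f,g)`, that is, for which `b((f,g))` is a unit of `K(x) × K(y)`. -/
def adjoinPair (f g : RatFunc K) : Set (RatFunc K × RatFunc K) :=
  {z | ∃ a b : Polynomial K, Polynomial.aeval f b ≠ 0 ∧ Polynomial.aeval g b ≠ 0 ∧
    z = (Polynomial.aeval f a / Polynomial.aeval f b, Polynomial.aeval g a / Polynomial.aeval g b)}

end NearSep

end

/-!
The argument works over an arbitrary field `K`.

If `p` lies in `K[x]` or in `K[y]`, it is itself near-separated and hence its own minimal
near-separated multiple. Otherwise `p` has no nonconstant factor in `K[x]` or in `K[y]`. For every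
polynomial `D` with this property (`NoUnivariateFactor`), all of `K(x)` and `K(y)` lies in the ring
`regularAt D` of fractions with denominator coprime to `D`, and `D` divides `f_n g_d - g_n f_d`
exactly when `f(x)` and `g(y)` are congruent modulo `D` in this ring (`sepCong_iff_dvd`). Congruent
pairs are stable under the field operations, so for `D = p` they form the field `F(p)`. In a pair
`(f, g)` of `F(p)` each component determines the other, so `F(p)` is isomorphic to its projection
to `K(x)`, an intermediate field of `K(x)/K`, and Lüroth's theorem gives `F(p) = K((f, g))` for
some `(f, g)`.

If `F(p) = K((f, g))`, every near-separated multiple of `p` comes from a pair `(h(f), h(g))`. When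
`f` and `g` are not constant, the polynomial `D = f_n g_d - g_n f_d` has no univariate factor
either (`noUnivariateFactor_crossDiff`), so the congruence of `f` and `g` modulo `D` passes to
`h(f)` and `h(g)`; hence `D` divides the given multiple. This proves minimality and, by Lüroth's
theorem, existence.

Conversely, let `f_n g_d - g_n f_d` be minimal and let `(f₀, g₀)` generate `F(p)`. Then
`K(f) ⊆ K(f₀)`. If `f₀` is constant, both fields are `K`. Otherwise all four functions are
nonconstant, the degree in `x` of the polynomial of such a pair is the degree of its first
component, and minimality gives `deg f ≤ deg f₀`. As `[K(x) : K(f)] = deg f`, the two fields agree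
(`projField_eq_adjoin_of_isMinimal`).
-/

noncomputable section

namespace NearSep

variable {K : Type*} [Field K]

/-! ### Univariate factors of bivariate polynomials -/

theorem aeval_X_injective (i : Fin 2) :
    Function.Injective (Polynomial.aeval (MvPolynomial.X i : Poly₂ K) :
      Polynomial K →ₐ[K] Poly₂ K) :=
  transcendental_iff_injective.mp (MvPolynomial.transcendental_X K i)

theorem mem_supported_singleton_iff (i : Fin 2) (p : Poly₂ K) :
    p ∈ MvPolynomial.supported K ({i} : Set (Fin 2)) ↔
      ∃ q : Polynomial K, Polynomial.aeval (MvPolynomial.X i) q = p := by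
  rw [MvPolynomial.supported, Set.image_singleton, Algebra.adjoin_singleton_eq_range_aeval,
    AlgHom.mem_range]

/-- A divisor of a nonzero polynomial in one of the variables involves only that variable. -/
theorem exists_aeval_X_eq_of_dvd {i : Fin 2} {q : Polynomial K} (hq : q ≠ 0) {d : Poly₂ K}
    (hd : d ∣ Polynomial.aeval (MvPolynomial.X i) q) :
    ∃ r : Polynomial K, Polynomial.aeval (MvPolynomial.X i) r = d := by
  classical
  rw [← mem_supported_singleton_iff, MvPolynomial.mem_supported]
  have hne : Polynomial.aeval (MvPolynomial.X i : Poly₂ K) q ≠ 0 :=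
    (map_ne_zero_iff _ (aeval_X_injective i)).mpr hq
  have hmem := (mem_supported_singleton_iff i _).mpr ⟨q, rfl⟩
  rw [MvPolynomial.mem_supported] at hmem
  refine Set.Subset.trans ?_ hmem
  obtain ⟨e, he⟩ := hd
  rw [he] at hne ⊢
  rw [Finset.coe_subset, MvPolynomial.vars_def, MvPolynomial.vars_def,
    MvPolynomial.degrees_mul_eq (left_ne_zero_of_mul hne) (right_ne_zero_of_mul hne)]
  exact Multiset.toFinset_subset.mpr (Multiset.subset_of_le (Multiset.le_add_right _ _))

/-- `D` has no nonconstant factor in `K[x]` and none in `K[y]`. -/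
def NoUnivariateFactor (D : Poly₂ K) : Prop :=
  ∀ (i : Fin 2) (q : Polynomial K), q ≠ 0 → IsRelPrime D (Polynomial.aeval (MvPolynomial.X i) q)

theorem noUnivariateFactor_of_irreducible {p : Poly₂ K} (hp : Irreducible p)
    (h0 : p ∉ MvPolynomial.supported K ({0} : Set (Fin 2)))
    (h1 : p ∉ MvPolynomial.supported K ({1} : Set (Fin 2))) : NoUnivariateFactor p := by
  intro i q hq
  rw [hp.isRelPrime_iff_not_dvd]
  intro hd
  have := (mem_supported_singleton_iff i p).mpr (exists_aeval_X_eq_of_dvd hq hd)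
  fin_cases i
  · exact h0 this
  · exact h1 this

/-- For `i ≠ j`, a polynomial in `X i` alone that divides `u(X i) v(X j) - w(X j) t(X i)`
divides every coefficient with respect to `X j`. -/
theorem dvd_coeff_of_aeval_X_dvd {i j : Fin 2} (hij : i ≠ j) {r u t v w : Polynomial K}
    (h : (Polynomial.aeval (MvPolynomial.X i : Poly₂ K) r) ∣
      Polynomial.aeval (MvPolynomial.X i) u * Polynomial.aeval (MvPolynomial.X j) v -
        Polynomial.aeval (MvPolynomial.X j) w * Polynomial.aeval (MvPolynomial.X i) t) (n : ℕ) :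
    r ∣ u * Polynomial.C (v.coeff n) - Polynomial.C (w.coeff n) * t := by
  -- View bivariate polynomials as polynomials in `X j` with coefficients in `K[X i]`.
  let φ : Poly₂ K →ₐ[K] Polynomial (Polynomial K) :=
    MvPolynomial.aeval fun k => if k = i then Polynomial.C Polynomial.X else Polynomial.X
  have hi (q : Polynomial K) : φ (Polynomial.aeval (MvPolynomial.X i) q) = Polynomial.C q := by
    rw [← Polynomial.aeval_algHom_apply]
    have : φ (MvPolynomial.X i) = Polynomial.CAlgHom (R := K) (Polynomial.X : Polynomial K) := by
      simp [φ]
    rw [this, Polynomial.aeval_algHom_apply, Polynomial.aeval_X_left_apply]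
    rfl
  have hj (q : Polynomial K) :
      φ (Polynomial.aeval (MvPolynomial.X j) q) = q.map Polynomial.C := by
    rw [← Polynomial.aeval_algHom_apply]
    have : φ (MvPolynomial.X j) = Polynomial.X := by
      simp [φ, hij.symm]
    rw [this]
    exact Polynomial.aeval_X_left_eq_map q
  have h' := map_dvd φ h
  simp only [map_sub, map_mul, hi, hj] at h'
  simpa using (Polynomial.C_dvd_iff_dvd_coeff _ _).mp h' n

/-- The numerator of a nonconstant rational function is not a multiple of its denominator. -/
theorem exists_num_coeff_sub_ne_zero {g : RatFunc K} (hg : ¬∃ c, g = RatFunc.C c) (c : K) :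
    ∃ n, g.num.coeff n - c * g.denom.coeff n ≠ 0 := by
  by_contra! H
  refine hg ⟨c, ?_⟩
  have : g.num = Polynomial.C c * g.denom := by
    ext n
    simpa [sub_eq_zero] using H n
  rw [← RatFunc.num_div_denom g, this, map_mul, mul_div_cancel_right₀ _
    (RatFunc.algebraMap_ne_zero g.denom_ne_zero), RatFunc.algebraMap_C]

/-- A common divisor in `K[X i]` of all coefficients of the cross difference divides the numerator
and the denominator of `f`, because the numerator and the denominator of a nonconstant `g` are
linearly independent. The variables are kept general, so that the statement applies to both. -/
theorem isRelPrime_aeval_X {i j : Fin 2} (hij : i ≠ j) {f g : RatFunc K}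
    (hg : ¬∃ c, g = RatFunc.C c) {q : Polynomial K} (hq : q ≠ 0) :
    IsRelPrime (Polynomial.aeval (MvPolynomial.X i : Poly₂ K) f.num *
        Polynomial.aeval (MvPolynomial.X j) g.denom -
      Polynomial.aeval (MvPolynomial.X j) g.num * Polynomial.aeval (MvPolynomial.X i) f.denom)
      (Polynomial.aeval (MvPolynomial.X i) q) := by
  intro d hd hdq
  obtain ⟨r, rfl⟩ := exists_aeval_X_eq_of_dvd hq hdq
  have hr := dvd_coeff_of_aeval_X_dvd hij hd
  set N := g.denom.natDegree
  set c := g.num.coeff N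
  have hN : g.denom.coeff N = 1 := g.monic_denom
  -- The denominator of `g` is monic, so its leading coefficient gives a relation from which
  -- `f.num` can be eliminated.
  have h1 : r ∣ f.num - Polynomial.C c * f.denom := by simpa [hN] using hr N
  obtain ⟨n, hn⟩ := exists_num_coeff_sub_ne_zero hg c
  have h2 : r ∣ Polynomial.C (g.num.coeff n - c * g.denom.coeff n) * f.denom := by
    convert (h1.mul_right (Polynomial.C (g.denom.coeff n))).sub (hr n) using 1
    simp only [map_sub, map_mul]
    ring
  have h3 : r ∣ f.denom :=
    ((Polynomial.isUnit_C.mpr hn.isUnit).dvd_mul_left).mp h2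
  have h4 : r ∣ f.num := by
    simpa using h1.add (h3.mul_left (Polynomial.C c))
  exact (f.isCoprime_num_denom.isUnit_of_dvd' h4 h3).map _

theorem noUnivariateFactor_crossDiff {f g : RatFunc K} (hf : ¬∃ c, f = RatFunc.C c)
    (hg : ¬∃ c, g = RatFunc.C c) : NoUnivariateFactor (crossDiff f g) := by
  intro i q hq
  fin_cases i
  · exact isRelPrime_aeval_X (by decide) hg hq
  · have h := (isRelPrime_aeval_X (i := 1) (j := 0) (by decide) (f := g) hf hq).neg_left
    rwa [neg_sub] at h

/-! ### Fractions with denominator coprime to a given polynomial -/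

theorem nonZeroDivisors_le_comap_aeval_X (i : Fin 2) : nonZeroDivisors (Polynomial K) ≤
    (nonZeroDivisors (Rat₂ K)).comap (((Algebra.ofId (Poly₂ K) (Rat₂ K)).restrictScalars K).comp
      (Polynomial.aeval (MvPolynomial.X i : Poly₂ K))) :=
  nonZeroDivisors_le_comap_nonZeroDivisors_of_injective _
    ((FaithfulSMul.algebraMap_injective (Poly₂ K) (Rat₂ K)).comp (aeval_X_injective i))

/-- Substitution of one of the variables, as a homomorphism of `K`-algebras. -/
def inVarHom (i : Fin 2) : RatFunc K →ₐ[K] Rat₂ K :=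
  RatFunc.liftAlgHom _ (nonZeroDivisors_le_comap_aeval_X i)

theorem inVarHom_eq_div (i : Fin 2) (f : RatFunc K) : inVarHom i f =
    algebraMap (Poly₂ K) (Rat₂ K) (Polynomial.aeval (MvPolynomial.X i) f.num) /
      algebraMap (Poly₂ K) (Rat₂ K) (Polynomial.aeval (MvPolynomial.X i) f.denom) :=
  RatFunc.liftAlgHom_apply _ _ f

theorem inVar_eq_inVarHom (i : Fin 2) (f : RatFunc K) : inVar i f = inVarHom i f := by
  rw [inVarHom_eq_div, inVar, RatFunc.eval, ← Polynomial.aeval_def, ← Polynomial.aeval_def,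
    Polynomial.aeval_algebraMap_apply, Polynomial.aeval_algebraMap_apply]

theorem algebraMap_aeval_X_ne_zero (i : Fin 2) {q : Polynomial K} (hq : q ≠ 0) :
    algebraMap (Poly₂ K) (Rat₂ K) (Polynomial.aeval (MvPolynomial.X i) q) ≠ 0 :=
  (map_ne_zero_iff _ (FaithfulSMul.algebraMap_injective (Poly₂ K) (Rat₂ K))).mpr
    ((map_ne_zero_iff _ (aeval_X_injective i)).mpr hq)

theorem algebraMap_crossDiff (f g : RatFunc K) :
    algebraMap (Poly₂ K) (Rat₂ K) (crossDiff f g) =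
      (inVarHom 0 f - inVarHom 1 g) *
        algebraMap (Poly₂ K) (Rat₂ K) (Polynomial.aeval (MvPolynomial.X 0) f.denom *
          Polynomial.aeval (MvPolynomial.X 1) g.denom) := by
  have h0 := algebraMap_aeval_X_ne_zero (K := K) 0 f.denom_ne_zero
  have h1 := algebraMap_aeval_X_ne_zero (K := K) 1 g.denom_ne_zero
  rw [inVarHom_eq_div, inVarHom_eq_div, crossDiff]
  simp only [map_sub, map_mul]
  field_simp

/-- The ring of all elements of `K(x,y)` that can be written with a denominator coprime
to `D`. For irreducible `D` it is the localization of `K[x,y]` at `D`. -/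
def regularAt (D : Poly₂ K) : Subring (Rat₂ K) where
  carrier := {r | ∃ a b : Poly₂ K, IsRelPrime D b ∧
    r * algebraMap (Poly₂ K) (Rat₂ K) b = algebraMap (Poly₂ K) (Rat₂ K) a}
  mul_mem' := by
    rintro r s ⟨a, b, hb, h⟩ ⟨a', b', hb', h'⟩
    refine ⟨a * a', b * b', hb.mul_right hb', ?_⟩
    rw [map_mul, map_mul, ← h, ← h']
    ring
  one_mem' := ⟨1, 1, isRelPrime_one_right, by simp⟩
  add_mem' := by
    rintro r s ⟨a, b, hb, h⟩ ⟨a', b', hb', h'⟩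
    refine ⟨a * b' + a' * b, b * b', hb.mul_right hb', ?_⟩
    rw [map_mul, map_add, map_mul, map_mul, ← h, ← h']
    ring
  zero_mem' := ⟨0, 1, isRelPrime_one_right, by simp⟩
  neg_mem' := by
    rintro r ⟨a, b, hb, h⟩
    exact ⟨-a, b, hb, by rw [map_neg, ← h]; ring⟩

theorem algebraMap_mem_regularAt (D a : Poly₂ K) : algebraMap (Poly₂ K) (Rat₂ K) a ∈ regularAt D :=
  ⟨a, 1, isRelPrime_one_right, by simp⟩

theorem inVarHom_mem_regularAt {D : Poly₂ K} (hD : NoUnivariateFactor D) (i : Fin 2)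
    (f : RatFunc K) : inVarHom i f ∈ regularAt D :=
  ⟨_, _, hD i _ f.denom_ne_zero, by
    rw [inVarHom_eq_div, div_mul_cancel₀ _ (algebraMap_aeval_X_ne_zero i f.denom_ne_zero)]⟩

theorem dvd_of_algebraMap_eq_mul {D c : Poly₂ K} {s : Rat₂ K} (hs : s ∈ regularAt D)
    (h : algebraMap (Poly₂ K) (Rat₂ K) c = algebraMap (Poly₂ K) (Rat₂ K) D * s) : D ∣ c := by
  obtain ⟨a, b, hb, hab⟩ := hs
  have : c * b = D * a := by
    apply FaithfulSMul.algebraMap_injective (Poly₂ K) (Rat₂ K)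
    rw [map_mul, h, map_mul, ← hab, mul_assoc]
  exact hb.dvd_of_dvd_mul_right ⟨a, this⟩

/-- `f(x)` and `g(y)` are congruent modulo `D` in the ring of fractions whose denominator is
coprime to `D`. -/
def SepCong (D : Poly₂ K) (f g : RatFunc K) : Prop :=
  ∃ s ∈ regularAt D, inVarHom 0 f - inVarHom 1 g = algebraMap (Poly₂ K) (Rat₂ K) D * s

theorem sepCong_iff_dvd {D : Poly₂ K} (hD : NoUnivariateFactor D) {f g : RatFunc K} :
    SepCong D f g ↔ D ∣ crossDiff f g := by
  constructor
  · rintro ⟨s, hs, h⟩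
    refine dvd_of_algebraMap_eq_mul (mul_mem hs
      (algebraMap_mem_regularAt D (Polynomial.aeval (MvPolynomial.X 0) f.denom *
          Polynomial.aeval (MvPolynomial.X 1) g.denom))) ?_
    rw [algebraMap_crossDiff, h, mul_assoc]
  · rintro ⟨a, ha⟩
    have h0 := algebraMap_aeval_X_ne_zero (K := K) 0 f.denom_ne_zero
    have h1 := algebraMap_aeval_X_ne_zero (K := K) 1 g.denom_ne_zero
    refine ⟨algebraMap (Poly₂ K) (Rat₂ K) a / algebraMap (Poly₂ K) (Rat₂ K)
      (Polynomial.aeval (MvPolynomial.X 0) f.denom *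
          Polynomial.aeval (MvPolynomial.X 1) g.denom), ⟨a, _,
      (hD 0 _ f.denom_ne_zero).mul_right (hD 1 _ g.denom_ne_zero), ?_⟩, ?_⟩
    · exact div_mul_cancel₀ _ (by rw [map_mul]; exact mul_ne_zero h0 h1)
    · rw [mul_div_assoc', eq_div_iff (by rw [map_mul]; exact mul_ne_zero h0 h1),
        ← algebraMap_crossDiff, ha, map_mul]

/-! ### Congruence modulo a polynomial without univariate factors -/

namespace SepCong

variable {D : Poly₂ K} {f g f' g' : RatFunc K}

theorem algebraMap (c : K) :
    SepCong D (algebraMap K (RatFunc K) c) (algebraMap K (RatFunc K) c) :=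
  ⟨0, zero_mem _, by rw [AlgHom.commutes, AlgHom.commutes, sub_self, mul_zero]⟩

theorem add (h : SepCong D f g) (h' : SepCong D f' g') : SepCong D (f + f') (g + g') := by
  obtain ⟨s, hs, e⟩ := h
  obtain ⟨s', hs', e'⟩ := h'
  refine ⟨s + s', add_mem hs hs', ?_⟩
  rw [map_add, map_add, mul_add, ← e, ← e']
  ring

theorem mul (hD : NoUnivariateFactor D) (h : SepCong D f g) (h' : SepCong D f' g') :
    SepCong D (f * f') (g * g') := by
  obtain ⟨s, hs, e⟩ := h
  obtain ⟨s', hs', e'⟩ := h'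
  refine ⟨inVarHom 0 f * s' + inVarHom 1 g' * s,
    add_mem (mul_mem (inVarHom_mem_regularAt hD _ _) hs')
      (mul_mem (inVarHom_mem_regularAt hD _ _) hs), ?_⟩
  rw [map_mul, map_mul]
  linear_combination inVarHom 0 f * e' + inVarHom 1 g' * e

theorem sub (hD : NoUnivariateFactor D) (h : SepCong D f g) (h' : SepCong D f' g') :
    SepCong D (f - f') (g - g') := by
  have := h.add ((algebraMap (D := D) (-1)).mul hD h')
  simpa [sub_eq_add_neg] using this

theorem inv (hD : NoUnivariateFactor D) (hf : f ≠ 0) (hg : g ≠ 0) (h : SepCong D f g) :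
    SepCong D f⁻¹ g⁻¹ := by
  obtain ⟨s, hs, e⟩ := h
  refine ⟨-(s * inVarHom 0 f⁻¹ * inVarHom 1 g⁻¹), neg_mem (mul_mem (mul_mem hs
    (inVarHom_mem_regularAt hD _ _)) (inVarHom_mem_regularAt hD _ _)), ?_⟩
  have h0 : inVarHom 0 f ≠ 0 := (map_ne_zero _).mpr hf
  have h1 : inVarHom 1 g ≠ 0 := (map_ne_zero _).mpr hg
  rw [map_inv₀, map_inv₀]
  field_simp
  linear_combination -e

theorem aeval (hD : NoUnivariateFactor D) (h : SepCong D f g) (a : Polynomial K) :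
    SepCong D (Polynomial.aeval f a) (Polynomial.aeval g a) := by
  induction a using Polynomial.induction_on' with
  | add p q hp hq => simpa using hp.add hq
  | monomial n c =>
    simp only [Polynomial.aeval_monomial]
    refine (algebraMap c).mul hD ?_
    induction n with
    | zero => simpa using algebraMap (D := D) (1 : K)
    | succ n ih => simpa only [pow_succ] using ih.mul hD h

theorem aeval_div_aeval (hD : NoUnivariateFactor D) (h : SepCong D f g) (a b : Polynomial K)
    (hf : Polynomial.aeval f b ≠ 0) (hg : Polynomial.aeval g b ≠ 0) :
    SepCong D (Polynomial.aeval f a / Polynomial.aeval f b)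
      (Polynomial.aeval g a / Polynomial.aeval g b) := by
  rw [div_eq_mul_inv, div_eq_mul_inv]
  exact (h.aeval hD a).mul hD ((h.aeval hD b).inv hD hf hg)

theorem right_eq_zero (hD : NoUnivariateFactor D) (hu : ¬IsUnit D) (h : SepCong D 0 g) :
    g = 0 := by
  by_contra hg
  rw [sepCong_iff_dvd hD] at h
  have h1 : D ∣ Polynomial.aeval (MvPolynomial.X 1) g.num := by simpa [crossDiff] using h
  exact hu (hD 1 g.num (RatFunc.num_ne_zero hg) dvd_rfl h1)

theorem left_eq_zero (hD : NoUnivariateFactor D) (hu : ¬IsUnit D) (h : SepCong D f 0) :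
    f = 0 := by
  by_contra hf
  rw [sepCong_iff_dvd hD] at h
  have h1 : D ∣ Polynomial.aeval (MvPolynomial.X 0) f.num := by simpa [crossDiff] using h
  exact hu (hD 0 f.num (RatFunc.num_ne_zero hf) dvd_rfl h1)

theorem eq_of_left (hD : NoUnivariateFactor D) (hu : ¬IsUnit D) (h : SepCong D f g)
    (h' : SepCong D f g') : g = g' :=
  sub_eq_zero.mp (right_eq_zero hD hu (by simpa using h.sub hD h'))

theorem eq_of_right (hD : NoUnivariateFactor D) (hu : ¬IsUnit D) (h : SepCong D f g)
    (h' : SepCong D f' g) : f = f' :=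
  sub_eq_zero.mp (left_eq_zero hD hu (by simpa using h.sub hD h'))

theorem const_iff (hD : NoUnivariateFactor D) (hu : ¬IsUnit D) (h : SepCong D f g) (c : K) :
    f = RatFunc.C c ↔ g = RatFunc.C c :=
  ⟨by rintro rfl; exact h.eq_of_left hD hu (algebraMap c),
    by rintro rfl; exact h.eq_of_right hD hu (algebraMap c)⟩

end SepCong

/-! ### The field of separated multiples -/

theorem mem_localRing_iff {p : Poly₂ K} (hp : Irreducible p) (r : Rat₂ K) :
    r ∈ localRing p ↔ r ∈ regularAt p := by
  constructor
  · rintro ⟨a, b, hb, rfl⟩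
    refine ⟨a, b, hp.isRelPrime_iff_not_dvd.mpr hb, div_mul_cancel₀ _ ?_⟩
    refine (map_ne_zero_iff _ (FaithfulSMul.algebraMap_injective (Poly₂ K) (Rat₂ K))).mpr ?_
    rintro rfl
    exact hb (dvd_zero p)
  · rintro ⟨a, b, hb, h⟩
    rw [hp.isRelPrime_iff_not_dvd] at hb
    refine ⟨a, b, hb, (eq_div_iff ?_).mpr h⟩
    refine (map_ne_zero_iff _ (FaithfulSMul.algebraMap_injective (Poly₂ K) (Rat₂ K))).mpr ?_
    rintro rfl
    exact hb (dvd_zero p)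

theorem mem_sepField_iff {p : Poly₂ K} (hp : Irreducible p) (f g : RatFunc K) :
    (f, g) ∈ sepField p ↔ SepCong p f g := by
  simp only [sepField, localIdeal, SepCong, Set.mem_ofPred_eq, inVar_eq_inVarHom,
    mem_localRing_iff hp]

/-- The projection of the field of separated multiples to `K(x)`. Since `f` determines `g` in a
pair `(f, g)` of this field, it is isomorphic to its projection. -/
def projField {p : Poly₂ K} (hD : NoUnivariateFactor p) (hu : ¬IsUnit p) :
    IntermediateField K (RatFunc K) where
  carrier := {f | ∃ g, SepCong p f g}
  mul_mem' := fun ⟨_, h⟩ ⟨_, h'⟩ => ⟨_, h.mul hD h'⟩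
  add_mem' := fun ⟨_, h⟩ ⟨_, h'⟩ => ⟨_, h.add h'⟩
  algebraMap_mem' c := ⟨_, SepCong.algebraMap c⟩
  inv_mem' := by
    rintro f ⟨g, h⟩
    by_cases hf : f = 0
    · exact ⟨g, by rwa [hf, inv_zero, ← hf]⟩
    · refine ⟨g⁻¹, h.inv hD hf ?_⟩
      rintro rfl
      exact hf (h.left_eq_zero hD hu)

theorem mem_projField {p : Poly₂ K} (hD : NoUnivariateFactor p) (hu : ¬IsUnit p)
    {f : RatFunc K} : f ∈ projField hD hu ↔ ∃ g, SepCong p f g := Iff.rfl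

open IntermediateField in
/-- A generator of the projection to `K(x)` lifts to a generator of the field of separated
multiples. -/
theorem sepField_eq_adjoinPair {p : Poly₂ K} (hp : Irreducible p) (hD : NoUnivariateFactor p)
    {f g : RatFunc K} (h : SepCong p f g) (hgen : projField hD hp.not_isUnit = K⟮f⟯) :
    sepField p = adjoinPair f g := by
  have hu := hp.not_isUnit
  ext ⟨f', g'⟩
  rw [mem_sepField_iff hp]
  constructor
  · intro h'
    have hmem : f' ∈ K⟮f⟯ := hgen ▸ (mem_projField hD hu).mpr ⟨g', h'⟩
    obtain ⟨a, b, rfl⟩ := (mem_adjoin_simple_iff K f').mp hmem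
    -- If `b(f) = 0`, the quotient has the junk value `0`, which is also `0 / 1`.
    by_cases hb : Polynomial.aeval f b = 0
    · rw [hb, div_zero] at h' ⊢
      obtain rfl := h'.right_eq_zero hD hu
      exact ⟨0, 1, by simp, by simp, by simp⟩
    · have hb' : Polynomial.aeval g b ≠ 0 := by
        intro hb'
        have := h.aeval hD b
        rw [hb'] at this
        exact hb (this.left_eq_zero hD hu)
      refine ⟨a, b, hb, hb', ?_⟩
      rw [h'.eq_of_left hD hu (h.aeval_div_aeval hD a b hb hb')]
  · rintro ⟨a, b, hb, hb', e⟩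
    rw [Prod.mk.injEq] at e
    rw [e.1, e.2]
    exact h.aeval_div_aeval hD a b hb hb'

/-- Every near-separated multiple of `p` belongs to a pair `(h(f), h(g))`. For nonconstant `f` and
`g`, the congruence of `f` and `g` modulo `crossDiff f g` itself passes to `h(f)` and `h(g)`. -/
theorem isMinimalNearSeparatedMultiple_of_sepField_eq {p : Poly₂ K} (hp : Irreducible p)
    (hD : NoUnivariateFactor p) {f g : RatFunc K} (h : sepField p = adjoinPair f g) :
    IsMinimalNearSeparatedMultiple p (crossDiff f g) := by
  have hu := hp.not_isUnit
  have hfg : SepCong p f g := by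
    rw [← mem_sepField_iff hp, h]
    exact ⟨Polynomial.X, 1, by simp, by simp, by simp⟩
  refine ⟨⟨f, g, rfl⟩, (sepCong_iff_dvd hD).mp hfg, ?_⟩
  rintro _ ⟨f', g', rfl⟩ hdvd
  have hmem : (f', g') ∈ adjoinPair f g := by
    rwa [← h, mem_sepField_iff hp, sepCong_iff_dvd hD]
  obtain ⟨a, b, hb, hb', e⟩ := hmem
  rw [Prod.mk.injEq] at e
  by_cases hf : ∃ c, f = RatFunc.C c
  · obtain ⟨c, hc⟩ := hf
    have hg := (hfg.const_iff hD hu c).mp hc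
    have hfg' : f' = g' := by rw [e.1, e.2, hc, hg]
    obtain ⟨c', hc'⟩ : ∃ c', f' = RatFunc.C c' := by
      refine ⟨a.eval c / b.eval c, ?_⟩
      rw [e.1, hc, ← RatFunc.algebraMap_eq_C, Polynomial.aeval_algebraMap_apply,
        Polynomial.aeval_algebraMap_apply, map_div₀]
      simp
    have : crossDiff f' g' = 0 := by simp [crossDiff, ← hfg', hc']
    rw [this]
    exact dvd_zero _
  · have hg : ¬∃ c, g = RatFunc.C c := fun ⟨c, hc⟩ => hf ⟨c, (hfg.const_iff hD hu c).mpr hc⟩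
    have hN := noUnivariateFactor_crossDiff hf hg
    rw [← sepCong_iff_dvd hN, e.1, e.2]
    exact ((sepCong_iff_dvd hN).mpr dvd_rfl).aeval_div_aeval hN a b hb hb'

open IntermediateField in
/-- Lüroth's theorem for the field of separated multiples. -/
theorem exists_projField_eq_adjoin {p : Poly₂ K} (hD : NoUnivariateFactor p) (hu : ¬IsUnit p) :
    ∃ f g, SepCong p f g ∧ projField hD hu = K⟮f⟯ := by
  obtain ⟨g, hg⟩ := (mem_projField hD hu).mp RatFunc.Luroth.generator_mem
  exact ⟨_, g, hg, RatFunc.Luroth.eq_adjoin_generator⟩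

/-! ### The degree of a cross difference -/

/-- The homomorphism from `K[x,y]` to `K(y)[x]`. -/
def toPolyX : Poly₂ K →ₐ[K] Polynomial (RatFunc K) :=
  MvPolynomial.aeval ![Polynomial.X, Polynomial.C RatFunc.X]

theorem toPolyX_crossDiff (f g : RatFunc K) : toPolyX (crossDiff f g) =
    f.num.map RatFunc.C * Polynomial.C (algebraMap _ (RatFunc K) g.denom) -
      Polynomial.C (algebraMap _ (RatFunc K) g.num) * f.denom.map RatFunc.C := by
  have h0 (q : Polynomial K) :
      toPolyX (Polynomial.aeval (MvPolynomial.X 0 : Poly₂ K) q) = q.map RatFunc.C := by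
    rw [← Polynomial.aeval_algHom_apply]
    simp only [toPolyX, MvPolynomial.aeval_X, Matrix.cons_val_zero]
    rw [Polynomial.aeval_X_left_eq_map, RatFunc.algebraMap_eq_C]
  have h1 (q : Polynomial K) :
      toPolyX (Polynomial.aeval (MvPolynomial.X 1 : Poly₂ K) q) =
        Polynomial.C (algebraMap _ (RatFunc K) q) := by
    rw [← Polynomial.aeval_algHom_apply]
    simp only [toPolyX, MvPolynomial.aeval_X, Matrix.cons_val_one, Matrix.cons_val_fin_one]
    rw [← RatFunc.aeval_X_left_eq_algebraMap]
    exact Polynomial.aeval_algHom_apply (Polynomial.CAlgHom (R := K) (A := RatFunc K)) RatFunc.X q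
  rw [crossDiff, map_sub, map_mul, map_mul, h0, h0, h1, h1]

/-- As `g` is not constant, its numerator and denominator are linearly independent over `K`, so no
coefficient of the cross difference with respect to `x` vanishes by cancellation. -/
theorem coeff_toPolyX_crossDiff_ne_zero {f g : RatFunc K} (hg : ¬∃ c, g = RatFunc.C c) {n : ℕ}
    (hn : f.num.coeff n ≠ 0 ∨ f.denom.coeff n ≠ 0) : (toPolyX (crossDiff f g)).coeff n ≠ 0 := by
  intro h
  have hd : algebraMap (Polynomial K) (RatFunc K) g.denom ≠ 0 :=
    RatFunc.algebraMap_ne_zero g.denom_ne_zero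
  have h' : RatFunc.C (f.num.coeff n) = g * RatFunc.C (f.denom.coeff n) := by
    rw [toPolyX_crossDiff] at h
    simp only [Polynomial.coeff_sub, Polynomial.coeff_mul_C, Polynomial.coeff_C_mul,
      Polynomial.coeff_map] at h
    rw [← RatFunc.num_div_denom g]
    field_simp
    linear_combination h
  by_cases h0 : f.denom.coeff n = 0
  · rw [h0, map_zero, mul_zero, map_eq_zero] at h'
    exact hn.elim (· h') (· h0)
  · refine hg ⟨f.num.coeff n / f.denom.coeff n, ?_⟩
    rw [map_div₀, eq_div_iff ((map_ne_zero _).mpr h0), h']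

theorem max_natDegree_le_natDegree_toPolyX {f g : RatFunc K} (hg : ¬∃ c, g = RatFunc.C c) :
    max f.num.natDegree f.denom.natDegree ≤ (toPolyX (crossDiff f g)).natDegree := by
  refine max_le ?_ (Polynomial.le_natDegree_of_ne_zero
    (coeff_toPolyX_crossDiff_ne_zero hg (Or.inr ?_)))
  · by_cases hf : f.num = 0
    · simp [hf]
    · exact Polynomial.le_natDegree_of_ne_zero
        (coeff_toPolyX_crossDiff_ne_zero hg (Or.inl (by simpa using hf)))
  · simpa using f.denom_ne_zero

theorem natDegree_toPolyX_le (f g : RatFunc K) :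
    (toPolyX (crossDiff f g)).natDegree ≤ max f.num.natDegree f.denom.natDegree := by
  rw [toPolyX_crossDiff]
  refine (Polynomial.natDegree_sub_le _ _).trans (max_le_max ?_ ?_)
  · exact (Polynomial.natDegree_mul_C_le _ _).trans Polynomial.natDegree_map_le
  · exact (Polynomial.natDegree_C_mul_le _ _).trans Polynomial.natDegree_map_le

theorem toPolyX_crossDiff_ne_zero (f : RatFunc K) {g : RatFunc K} (hg : ¬∃ c, g = RatFunc.C c) :
    toPolyX (crossDiff f g) ≠ 0 := by
  intro h
  refine coeff_toPolyX_crossDiff_ne_zero (f := f) (n := f.denom.natDegree) hg (Or.inr ?_) ?_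
  · simpa using f.denom_ne_zero
  · rw [h, Polynomial.coeff_zero]

open IntermediateField in
/-- The projection of `F(p)` has a generator `f₀`, and divisibility bounds `deg f` by `deg f₀`.
Since `[K(x) : K(f)] = deg f`, the inclusion of `K(f)` in `K(f₀)` is an equality. -/
theorem projField_eq_adjoin_of_isMinimal {p : Poly₂ K} (hD : NoUnivariateFactor p)
    (hu : ¬IsUnit p) {f g : RatFunc K}
    (h : IsMinimalNearSeparatedMultiple p (crossDiff f g)) : projField hD hu = K⟮f⟯ := by
  obtain ⟨f₀, g₀, h₀, hgen⟩ := exists_projField_eq_adjoin hD hu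
  have hfg : SepCong p f g := (sepCong_iff_dvd hD).mpr h.2.1
  have hle : K⟮f⟯ ≤ K⟮f₀⟯ := by
    rw [← hgen, adjoin_simple_le_iff]
    exact ⟨g, hfg⟩
  rw [hgen]
  by_cases hf₀ : ∃ c, f₀ = RatFunc.C c
  · obtain ⟨c, rfl⟩ := hf₀
    have hbot : K⟮RatFunc.C c⟯ = ⊥ :=
      adjoin_simple_eq_bot_iff.mpr (IntermediateField.algebraMap_mem ⊥ c)
    rw [hbot] at hle ⊢
    exact (le_bot_iff.mp hle).symm
  have hg₀ : ¬∃ c, g₀ = RatFunc.C c :=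
    fun ⟨c, hc⟩ => hf₀ ⟨c, (h₀.const_iff hD hu c).mpr hc⟩
  have hdvd : crossDiff f g ∣ crossDiff f₀ g₀ :=
    h.2.2 _ ⟨f₀, g₀, rfl⟩ ((sepCong_iff_dvd hD).mp h₀)
  have hne := toPolyX_crossDiff_ne_zero f₀ hg₀
  have hf : ¬∃ c, f = RatFunc.C c := by
    rintro ⟨c, rfl⟩
    obtain rfl := (hfg.const_iff hD hu c).mp rfl
    refine hne ?_
    rw [show crossDiff f₀ g₀ = 0 by simpa [crossDiff] using hdvd, map_zero]
  have hg : ¬∃ c, g = RatFunc.C c := fun ⟨c, hc⟩ => hf ⟨c, (hfg.const_iff hD hu c).mpr hc⟩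
  have hdeg : Module.finrank K⟮f⟯ (RatFunc K) ≤ Module.finrank K⟮f₀⟯ (RatFunc K) := by
    rw [RatFunc.finrank_eq_max_natDegree, RatFunc.finrank_eq_max_natDegree]
    exact (max_natDegree_le_natDegree_toPolyX hg).trans <|
      (Polynomial.natDegree_le_of_dvd (map_dvd toPolyX hdvd) hne).trans
        (natDegree_toPolyX_le f₀ g₀)
  have : FiniteDimensional K⟮f⟯ (RatFunc K) := by
    refine FiniteDimensional.of_finrank_pos ?_
    rw [RatFunc.finrank_eq_max_natDegree, Nat.pos_iff_ne_zero]
    intro h0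
    exact hf ((RatFunc.eq_C_iff f).mpr (Nat.max_eq_zero_iff.mp h0))
  exact (eq_of_le_of_finrank_le' hle hdeg).symm

/-! ### Minimal near-separated multiples -/

theorem isMinimalNearSeparatedMultiple_self {p : Poly₂ K} (i : Fin 2)
    (h : p ∈ MvPolynomial.supported K ({i} : Set (Fin 2))) :
    IsMinimalNearSeparatedMultiple p p := by
  refine ⟨?_, dvd_rfl, fun q _ hq => hq⟩
  obtain ⟨q, rfl⟩ := (mem_supported_singleton_iff i p).mp h
  fin_cases i
  · exact ⟨algebraMap _ _ q, 0, by simp [crossDiff]⟩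
  · exact ⟨0, algebraMap _ _ (-q), by simp [crossDiff, -map_neg]⟩

theorem exists_isMinimalNearSeparatedMultiple {p : Poly₂ K} (hp : Irreducible p) :
    ∃ m, IsMinimalNearSeparatedMultiple p m := by
  by_cases h0 : p ∈ MvPolynomial.supported K ({0} : Set (Fin 2))
  · exact ⟨p, isMinimalNearSeparatedMultiple_self 0 h0⟩
  by_cases h1 : p ∈ MvPolynomial.supported K ({1} : Set (Fin 2))
  · exact ⟨p, isMinimalNearSeparatedMultiple_self 1 h1⟩
  have hD := noUnivariateFactor_of_irreducible hp h0 h1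
  obtain ⟨f, g, h, hgen⟩ := exists_projField_eq_adjoin hD hp.not_isUnit
  exact ⟨_, isMinimalNearSeparatedMultiple_of_sepField_eq hp hD
    (sepField_eq_adjoinPair hp hD h hgen)⟩

theorem IsMinimalNearSeparatedMultiple.eq_C_mul {p m m' : Poly₂ K}
    (h : IsMinimalNearSeparatedMultiple p m) (h' : IsMinimalNearSeparatedMultiple p m') :
    ∃ c : K, c ≠ 0 ∧ m' = MvPolynomial.C c * m := by
  obtain ⟨u, hu⟩ := associated_of_dvd_dvd (h.2.2 m' h'.1 h'.2.1) (h'.2.2 m h.1 h.2.1)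
  obtain ⟨c, hc, hcu⟩ := MvPolynomial.isUnit_iff_eq_C_of_isReduced.mp u.isUnit
  exact ⟨c, hc.ne_zero, by rw [← hu, hcu, mul_comm]⟩

end NearSep

end

theorem mainTheorem3 {K : Type*} [Field K] [IsAlgClosed K] [CharZero K]
    (p : NearSep.Poly₂ K) (hp : Irreducible p) :
    (∃ m : NearSep.Poly₂ K, NearSep.IsMinimalNearSeparatedMultiple p m) ∧
    (∀ m m' : NearSep.Poly₂ K,
      NearSep.IsMinimalNearSeparatedMultiple p m →
      NearSep.IsMinimalNearSeparatedMultiple p m' →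
      ∃ c : K, c ≠ 0 ∧ m' = MvPolynomial.C c * m) ∧
    (p ∉ MvPolynomial.supported K ({0} : Set (Fin 2)) →
      p ∉ MvPolynomial.supported K ({1} : Set (Fin 2)) →
      ∀ f g : RatFunc K,
        NearSep.sepField p = NearSep.adjoinPair f g ↔
          NearSep.IsMinimalNearSeparatedMultiple p (NearSep.crossDiff f g)) := by
  refine ⟨NearSep.exists_isMinimalNearSeparatedMultiple hp, fun m m' h h' => h.eq_C_mul h',
    fun h0 h1 f g => ?_⟩
  have hD := NearSep.noUnivariateFactor_of_irreducible hp h0 h1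
  exact ⟨NearSep.isMinimalNearSeparatedMultiple_of_sepField_eq hp hD, fun h =>
    NearSep.sepField_eq_adjoinPair hp hD ((NearSep.sepCong_iff_dvd hD).mpr h.2.1)
      (NearSep.projField_eq_adjoin_of_isMinimal hD hp.not_isUnit h)⟩
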